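/- Let $n\ge 1$ and $m\ge 0$ be integers and let $\Delta=(\Delta_1,\dots,\Delta_n)$ be an $\mathbb{R}^n$-valued function of $(x,d)\in\mathbb{R}^n\times\mathbb{R}^m$ such that each component $\Delta_i$ is real analytic at every point of $[-1,1]^n\times[-1,1]^m$ (jointly in $(x,d)$). Let $T_k$ denote the $k$-th Chebyshev polynomial of the first kind. Then for every $\epsilon'>0$ there are integers $p=p(\epsilon')\ge 0$, $s_1=(p+1)^{m+n}$ and $s_2=(p+1)^m$, a constant matrix $\Theta\in\mathbb{R}^{n\times s_1}$, a matrix-valued function $\mathcal{B}(x)\in\mathbb{R}^{s_1\times s_2}$ each of whose entries is either identically $0$ or a product $T_{k_1}(x_1)\cdots T_{k_n}(x_n)$ with $0\le k_1,\dots,k_n\le p$, and a vector-valued function $\xi(d)\in\mathbb{R}^{s_2}$ each of whose entries is a product $T_{l_1}(d_1)\cdots T_{l_m}(d_m)$ with $0\le l_1,\dots,l_m\le p$, such that $$\sup_{(x,d)\in[-1,1]^n\times[-1,1]^m}\bigl\|\Delta(x,d)-\Theta\,\mathcal{B}(x)\,\xi(d)\bigr\|_2\le\epsilon' .$$ Moreover,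 these can be chosen such that, as $\epsilon'\to 0^+$, with implied constants depending only on $\Delta$ (and so on $n$ and $m$), $$s_1=O\bigl(\log(\sqrt{n}/\epsilon')^{m+n}\bigr),\qquad s_2=O\bigl(\log(\sqrt{n}/\epsilon')^{m}\bigr),$$ where $\log(\cdot)^k$ means $(\log(\cdot))^k$. -/

import Mathlib

open Filter Topology Asymptotics

/-- `f` is a product of Chebyshev polynomials of the first kind of order at most `p`, one in each
of the `r` coordinates: `f x = T_{k₁}(x₁) ⋯ T_{kᵣ}(xᵣ)`. -/
def IsChebyshevProduct {r : ℕ} (p : ℕ) (f : (Fin r → ℝ) → ℝ) : Prop :=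
  ∃ k : Fin r → ℕ, (∀ i, k i ≤ p) ∧
    ∀ x, f x = ∏ i, (Polynomial.Chebyshev.T ℝ (k i : ℤ)).eval (x i)

/-- Every entry of the vector-valued function `ξ` is a Chebyshev product of order at most `p`. -/
def IsChebyshevVector {r s : ℕ} (p : ℕ) (ξ : (Fin r → ℝ) → Fin s → ℝ) : Prop :=
  ∀ j, IsChebyshevProduct p (fun d => ξ d j)

/-- Every entry of the matrix-valued function `B` is identically zero or a Chebyshev product of
order at most `p`. -/
def IsChebyshevMatrix {r s t : ℕ} (p : ℕ)
    (B : (Fin r → ℝ) → Matrix (Fin s) (Fin t) ℝ) : Prop :=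
  ∀ i j, (∀ x, B x i j = 0) ∨ IsChebyshevProduct p (fun x => B x i j)

/-! It suffices to approximate a function analytic near the cube with error `C * a ^ q`, `a < 1`, by
polynomials of coordinate degree linear in `q`; then `q` of order `log (1 / ε)` suffices. No complex
extension is used: local Taylor polynomials are glued by Bernstein weights. By compactness
(`exists_local_coordPoly_approx`) the Taylor polynomials err by at most `C * a ^ q` within a fixed
distance `δ` of their nodes and grow at most like `A ^ q` on the whole cube. Tensor Bernstein
weights of degree `D` form a polynomial partition of unity whose mass at distance at least `δ` is
`O(exp (-δ² D / 4))`, by a Chernoff bound (`sum_tensorBernstein_far_le`). Taking `D` a large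
multiple of `q + 1` beats `A ^ q` (`exists_coordPoly_approx`). The glued polynomial is expanded in
Chebyshev products, and `exists_chebyshev_factorization` separates `x` from `d`. -/

/-! ### Polynomials of bounded coordinate degree and their Chebyshev expansions. -/

/-- Polynomial functions on `ι → ℝ` of degree at most `d` in each coordinate. -/
def coordPoly (ι : Type*) [Fintype ι] (d : ℕ) : Submodule ℝ ((ι → ℝ) → ℝ) :=
  Submodule.span ℝ
    {f | ∃ g : ι → Polynomial ℝ, (∀ i, (g i).natDegree ≤ d) ∧ f = fun x => ∏ i, (g i).eval (x i)}

section coordPoly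

variable {ι : Type*} [Fintype ι]

lemma prod_eval_mem_coordPoly {d : ℕ} {g : ι → Polynomial ℝ} (hg : ∀ i, (g i).natDegree ≤ d) :
    (fun x : ι → ℝ => ∏ i, (g i).eval (x i)) ∈ coordPoly ι d :=
  Submodule.subset_span ⟨g, hg, rfl⟩

lemma coordPoly_mono {d e : ℕ} (h : d ≤ e) : coordPoly ι d ≤ coordPoly ι e :=
  Submodule.span_mono fun _ ⟨g, hg, hf⟩ => ⟨g, fun i => (hg i).trans h, hf⟩

lemma mul_mem_coordPoly {d e : ℕ} {f g : (ι → ℝ) → ℝ} (hf : f ∈ coordPoly ι d)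
    (hg : g ∈ coordPoly ι e) : f * g ∈ coordPoly ι (d + e) := by
  have h := Submodule.mul_mem_mul hf hg
  rw [coordPoly, coordPoly, Submodule.span_mul_span] at h
  refine Submodule.span_mono ?_ h
  rintro _ ⟨_, ⟨a, ha, rfl⟩, _, ⟨b, hb, rfl⟩, rfl⟩
  refine ⟨fun i => a i * b i, fun i => ?_, ?_⟩
  · exact Polynomial.natDegree_mul_le.trans (add_le_add (ha i) (hb i))
  · funext x
    simp [Finset.prod_mul_distrib]

lemma const_mem_coordPoly (c : ℝ) (d : ℕ) : (fun _ : ι → ℝ => c) ∈ coordPoly ι d := by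
  have h := (coordPoly ι d).smul_mem c
    (prod_eval_mem_coordPoly (ι := ι) (d := d) (g := fun _ => 1) (by simp))
  convert h using 1
  funext x
  simp

lemma coord_mem_coordPoly (i : ι) : (fun x : ι → ℝ => x i) ∈ coordPoly ι 1 := by
  classical
  convert prod_eval_mem_coordPoly (ι := ι) (d := 1)
    (g := fun j => if j = i then Polynomial.X else 1) ?_ using 1
  · funext x
    rw [Finset.prod_eq_single i] <;> simp +contextual
  · intro j
    split_ifs <;> simp

lemma prod_mem_coordPoly {k : ℕ} {f : Fin k → (ι → ℝ) → ℝ} (hf : ∀ j, f j ∈ coordPoly ι 1) :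
    (fun x => ∏ j, f j x) ∈ coordPoly ι k := by
  induction k with
  | zero => simpa using const_mem_coordPoly (ι := ι) 1 0
  | succ k ih =>
    have h := mul_mem_coordPoly (ih (f := fun j => f j.castSucc) fun j => hf _) (hf (Fin.last k))
    convert h using 1
    funext x
    simp [Fin.prod_univ_castSucc]

lemma multilinear_diag_mem_coordPoly {k : ℕ} (p : (ι → ℝ) [×k]→L[ℝ] ℝ) (z : ι → ℝ) :
    (fun x => p fun _ => x - z) ∈ coordPoly ι k := by
  classical
  have h : (fun x => p fun _ => x - z) = ∑ r : Fin k → ι,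
      (p fun j => Pi.single (r j) 1) • fun x : ι → ℝ => ∏ j, (x (r j) - z (r j)) := by
    funext x
    have hx : x - z = ∑ i, (x i - z i) • (Pi.single i 1 : ι → ℝ) := by
      conv_lhs => rw [pi_eq_sum_univ' (x - z)]
      simp [Pi.single]
    conv_lhs => rw [hx, p.map_sum]
    simp only [Finset.sum_apply, Pi.smul_apply, p.map_smul_univ, smul_eq_mul]
    exact Finset.sum_congr rfl fun r _ => mul_comm _ _
  rw [h]
  refine Submodule.sum_mem _ fun r _ => Submodule.smul_mem _ _ (prod_mem_coordPoly fun j => ?_)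
  exact (coordPoly ι 1).sub_mem (coord_mem_coordPoly (r j)) (const_mem_coordPoly (z (r j)) 1)

lemma partialSum_mem_coordPoly (p : FormalMultilinearSeries ℝ (ι → ℝ) ℝ) (z : ι → ℝ) (q : ℕ) :
    (fun x => p.partialSum q (x - z)) ∈ coordPoly ι q := by
  have h : (fun x => p.partialSum q (x - z)) =
      ∑ k ∈ Finset.range q, fun x => p k fun _ => x - z := by
    funext x
    simp [FormalMultilinearSeries.partialSum]
  rw [h]
  exact Submodule.sum_mem _ fun k hk =>
    coordPoly_mono (Finset.mem_range.mp hk).le (multilinear_diag_mem_coordPoly (p k) z)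

/-- The Chebyshev polynomial of index `d + 1` has degree exactly `d + 1`, so subtracting a multiple
of it removes the top coefficient. -/
lemma exists_chebyshev_expansion {d : ℕ} {g : Polynomial ℝ} (hg : g.natDegree ≤ d) :
    ∃ c : Fin (d + 1) → ℝ, g = ∑ k, c k • Polynomial.Chebyshev.T ℝ ((k : ℕ) : ℤ) := by
  induction d generalizing g with
  | zero =>
    refine ⟨fun _ => g.coeff 0, ?_⟩
    conv_lhs => rw [Polynomial.eq_C_of_natDegree_le_zero hg]
    simp [Polynomial.smul_eq_C_mul]
  | succ d ih =>
    set t := Polynomial.Chebyshev.T ℝ ((d + 1 : ℕ) : ℤ) with ht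
    have hd : t.natDegree = d + 1 := by rw [ht, Polynomial.Chebyshev.natDegree_T]; rfl
    have hl : t.coeff (d + 1) ≠ 0 := by
      rw [← hd]
      simpa using fun h : t = 0 => by simp [h] at hd
    obtain ⟨c, hc⟩ := ih (g := g - (g.coeff (d + 1) / t.coeff (d + 1)) • t) <| by
      rw [Polynomial.natDegree_le_iff_coeff_eq_zero]
      intro N hN
      rcases (Nat.succ_le_of_lt hN).eq_or_lt with rfl | h
      · simp [hl]
      · rw [Polynomial.coeff_sub, Polynomial.coeff_smul,
          Polynomial.coeff_eq_zero_of_natDegree_lt (hg.trans_lt h),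
          Polynomial.coeff_eq_zero_of_natDegree_lt (hd.trans_lt h)]
        simp
    refine ⟨Fin.snoc c (g.coeff (d + 1) / t.coeff (d + 1)), ?_⟩
    rw [Fin.sum_univ_castSucc]
    simp only [Fin.snoc_castSucc, Fin.snoc_last, Fin.val_castSucc, Fin.val_last, ← hc]
    exact (sub_add_cancel _ _).symm

lemma exists_chebyshev_coeff_of_mem_coordPoly [DecidableEq ι] {d : ℕ} {f : (ι → ℝ) → ℝ}
    (hf : f ∈ coordPoly ι d) :
    ∃ a : (ι → Fin (d + 1)) → ℝ, ∀ x,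
      f x = ∑ k, a k * ∏ i, (Polynomial.Chebyshev.T ℝ ((k i : ℕ) : ℤ)).eval (x i) := by
  induction hf using Submodule.span_induction with
  | mem f h =>
    obtain ⟨g, hg, rfl⟩ := h
    choose c hc using fun i => exists_chebyshev_expansion (hg i)
    refine ⟨fun k => ∏ i, c i (k i), fun x => ?_⟩
    simp only [← Finset.prod_mul_distrib]
    rw [← Fintype.prod_sum fun i k =>
      c i k * (Polynomial.Chebyshev.T ℝ ((k : ℕ) : ℤ)).eval (x i)]
    refine Finset.prod_congr rfl fun i _ => ?_
    conv_lhs => rw [hc i]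
    simp [Polynomial.eval_finsetSum]
  | zero => exact ⟨0, by simp⟩
  | add f g _ _ hf hg =>
    obtain ⟨a, ha⟩ := hf
    obtain ⟨b, hb⟩ := hg
    exact ⟨a + b, fun x => by simp [ha, hb, add_mul, Finset.sum_add_distrib]⟩
  | smul c f _ hf =>
    obtain ⟨a, ha⟩ := hf
    exact ⟨c • a, fun x => by simp [ha, Finset.mul_sum, mul_assoc]⟩

end coordPoly

/-! ### Concentration of Bernstein weights in one variable. -/

/-- The Bernstein polynomial of index `j` and degree `D`, transported to the interval `[-1, 1]`. -/
noncomputable def symmBernstein (D j : ℕ) : Polynomial ℝ :=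
  Polynomial.C (D.choose j : ℝ) * (Polynomial.C (1 / 2) * (1 + Polynomial.X)) ^ j *
    (Polynomial.C (1 / 2) * (1 - Polynomial.X)) ^ (D - j)

lemma eval_symmBernstein (D j : ℕ) (t : ℝ) : (symmBernstein D j).eval t =
    D.choose j * ((1 + t) / 2) ^ j * ((1 - t) / 2) ^ (D - j) := by
  simp [symmBernstein]
  ring

lemma natDegree_symmBernstein_le {D j : ℕ} (hj : j ≤ D) : (symmBernstein D j).natDegree ≤ D := by
  have h1 : (Polynomial.C (1 / 2 : ℝ) * (1 + Polynomial.X)).natDegree ≤ 1 := by compute_degree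
  have h2 : (Polynomial.C (1 / 2 : ℝ) * (1 - Polynomial.X)).natDegree ≤ 1 := by compute_degree
  rw [symmBernstein, mul_assoc]
  refine (Polynomial.natDegree_C_mul_le _ _).trans (Polynomial.natDegree_mul_le.trans ?_)
  have h3 := Polynomial.natDegree_pow_le_of_le j h1
  have h4 := Polynomial.natDegree_pow_le_of_le (D - j) h2
  omega

lemma symmBernstein_nonneg (D j : ℕ) {t : ℝ} (ht : t ∈ Set.Icc (-1 : ℝ) 1) :
    0 ≤ (symmBernstein D j).eval t := by
  rw [eval_symmBernstein]
  have h1 : 0 ≤ (1 + t) / 2 := by linarith [ht.1]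
  have h2 : 0 ≤ (1 - t) / 2 := by linarith [ht.2]
  positivity

lemma sum_symmBernstein_mul (D : ℕ) (t u v : ℝ) :
    ∑ j : Fin (D + 1), (symmBernstein D j).eval t * (u ^ (j : ℕ) * v ^ (D - j)) =
      (((1 + t) / 2) * u + ((1 - t) / 2) * v) ^ D := by
  rw [add_pow, Finset.sum_range]
  refine Finset.sum_congr rfl fun j _ => ?_
  rw [eval_symmBernstein, mul_pow, mul_pow]
  ring

lemma sum_symmBernstein (D : ℕ) (t : ℝ) :
    ∑ j : Fin (D + 1), (symmBernstein D j).eval t = 1 := by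
  have h := sum_symmBernstein_mul D t 1 1
  have h1 : (1 + t) / 2 * 1 + (1 - t) / 2 * 1 = 1 := by ring
  rw [h1] at h
  simpa using h

lemma exp_le_one_add_add_sq {x : ℝ} (hx : |x| ≤ 1) : Real.exp x ≤ 1 + x + x ^ 2 := by
  linarith [(abs_le.mp (Real.abs_exp_sub_one_sub_id_le hx)).2]

/-- The nodes `2 j / D - 1` of the Bernstein partition of unity on `[-1, 1]`. -/
noncomputable def symmNode (D j : ℕ) : ℝ := 2 * j / D - 1

lemma symmNode_mem_Icc {D j : ℕ} (hj : j ≤ D) : symmNode D j ∈ Set.Icc (-1 : ℝ) 1 := by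
  have h : (j : ℝ) / D ≤ 1 := div_le_one_of_le₀ (by exact_mod_cast hj) (by positivity)
  have h' : (0 : ℝ) ≤ j / D := by positivity
  rw [symmNode, mul_div_assoc]
  constructor <;> linarith

/-- Moment generating function of a centred binomial law with success probability `(1 + t) / 2`: it
is a `D`-th power, and in each factor the linear terms cancel. The bound on `μ` keeps the exponents
in `[-1, 1]`, where `exp x ≤ 1 + x + x²`. -/
lemma sum_symmBernstein_mul_exp_le {D : ℕ} (hD : 0 < D) {t μ : ℝ}
    (ht : t ∈ Set.Icc (-1 : ℝ) 1) (hμ : |μ| ≤ 1 / 2) :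
    ∑ j : Fin (D + 1), (symmBernstein D j).eval t * Real.exp (μ * (symmNode D j - t) * D) ≤
      Real.exp (μ ^ 2 * D) := by
  have hD' : (D : ℝ) ≠ 0 := by positivity
  have h : ∀ j : Fin (D + 1), Real.exp (μ * (symmNode D j - t) * D) =
      Real.exp (μ * (1 - t)) ^ (j : ℕ) * Real.exp (-(μ * (1 + t))) ^ (D - j) := by
    intro j
    rw [← Real.exp_nat_mul, ← Real.exp_nat_mul, ← Real.exp_add,
      Nat.cast_sub (Nat.lt_succ_iff.mp j.2), symmNode]
    congr 1
    field_simp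
    ring
  simp only [h]
  rw [sum_symmBernstein_mul, mul_comm (μ ^ 2), Real.exp_nat_mul]
  have h1 : 0 ≤ (1 + t) / 2 := by linarith [ht.1]
  have h2 : 0 ≤ (1 - t) / 2 := by linarith [ht.2]
  have e1 : |μ * (1 - t)| ≤ 1 := by
    rw [abs_mul, abs_of_nonneg (by linarith : 0 ≤ 1 - t)]
    nlinarith [abs_nonneg μ]
  have e2 : |-(μ * (1 + t))| ≤ 1 := by
    rw [abs_neg, abs_mul, abs_of_nonneg (by linarith : 0 ≤ 1 + t)]
    nlinarith [abs_nonneg μ]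
  refine pow_le_pow_left₀ (by positivity) ?_ D
  calc (1 + t) / 2 * Real.exp (μ * (1 - t)) + (1 - t) / 2 * Real.exp (-(μ * (1 + t)))
      ≤ (1 + t) / 2 * (1 + μ * (1 - t) + (μ * (1 - t)) ^ 2) +
        (1 - t) / 2 * (1 + -(μ * (1 + t)) + (-(μ * (1 + t))) ^ 2) := by
        gcongr
        · exact exp_le_one_add_add_sq e1
        · exact exp_le_one_add_add_sq e2
    _ ≤ μ ^ 2 + 1 := by nlinarith [mul_nonneg (sq_nonneg μ) (sq_nonneg t)]
    _ ≤ Real.exp (μ ^ 2) := Real.add_one_le_exp _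

/-- Chernoff bound with `μ = ± δ / 2`, one sign per tail: the exponent is `-δ² / 2 + δ² / 4` times
`D`. -/
lemma sum_symmBernstein_far_le {D : ℕ} (hD : 0 < D) {t δ : ℝ} (ht : t ∈ Set.Icc (-1 : ℝ) 1)
    (hδ : 0 < δ) (hδ1 : δ ≤ 1) :
    ∑ j : Fin (D + 1), (symmBernstein D j).eval t * (if δ ≤ |symmNode D j - t| then 1 else 0) ≤
      2 * Real.exp (-(δ ^ 2 / 4 * D)) := by
  have hμ : |δ / 2| ≤ 1 / 2 := by rw [abs_of_pos (by positivity)]; linarith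
  have h1 := sum_symmBernstein_mul_exp_le hD ht hμ
  have h2 := sum_symmBernstein_mul_exp_le hD ht (μ := -(δ / 2)) (by rwa [abs_neg])
  rw [neg_sq] at h2
  have hE : Real.exp (-(δ ^ 2 / 4 * D)) =
      Real.exp (-(δ ^ 2 / 2 * D)) * Real.exp ((δ / 2) ^ 2 * D) := by
    rw [← Real.exp_add]; congr 1; ring
  calc _ ≤ ∑ j : Fin (D + 1), (symmBernstein D j).eval t * (Real.exp (-(δ ^ 2 / 2 * D)) *
        (Real.exp (δ / 2 * (symmNode D j - t) * D) +
          Real.exp (-(δ / 2) * (symmNode D j - t) * D))) := by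
        refine Finset.sum_le_sum fun j _ => mul_le_mul_of_nonneg_left ?_
          (symmBernstein_nonneg D j ht)
        split_ifs with h
        · rw [mul_add, ← Real.exp_add, ← Real.exp_add]
          have hδD : 0 ≤ δ * D := by positivity
          rcases le_abs.mp h with h | h
          · have : 1 ≤ Real.exp (-(δ ^ 2 / 2 * D) + δ / 2 * (symmNode D j - t) * D) := by
              rw [Real.one_le_exp_iff]
              nlinarith
            linarith [Real.exp_pos (-(δ ^ 2 / 2 * D) + -(δ / 2) * (symmNode D j - t) * D)]
          · have : 1 ≤ Real.exp (-(δ ^ 2 / 2 * D) + -(δ / 2) * (symmNode D j - t) * D) := by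
              rw [Real.one_le_exp_iff]
              nlinarith
            linarith [Real.exp_pos (-(δ ^ 2 / 2 * D) + δ / 2 * (symmNode D j - t) * D)]
        · positivity
    _ = Real.exp (-(δ ^ 2 / 2 * D)) *
        (∑ j : Fin (D + 1), (symmBernstein D j).eval t *
            Real.exp (δ / 2 * (symmNode D j - t) * D) +
          ∑ j : Fin (D + 1), (symmBernstein D j).eval t *
            Real.exp (-(δ / 2) * (symmNode D j - t) * D)) := by
        rw [← Finset.sum_add_distrib, Finset.mul_sum]
        exact Finset.sum_congr rfl fun j _ => by ring
    _ ≤ Real.exp (-(δ ^ 2 / 2 * D)) *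
        (Real.exp ((δ / 2) ^ 2 * D) + Real.exp ((δ / 2) ^ 2 * D)) := by gcongr
    _ = _ := by rw [hE]; ring

lemma sum_prod_mul_marginal {ι κ : Type*} [Fintype ι] [DecidableEq ι] [Fintype κ]
    {w : ι → κ → ℝ} (hw : ∀ i, ∑ j, w i j = 1) (h : κ → ℝ) (i₀ : ι) :
    ∑ J : ι → κ, (∏ i, w i (J i)) * h (J i₀) = ∑ j, w i₀ j * h j := by
  have h1 : ∀ J : ι → κ, (∏ i, w i (J i)) * h (J i₀) =
      ∏ i, w i (J i) * (if i = i₀ then h (J i) else 1) := by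
    intro J
    rw [Finset.prod_mul_distrib]
    simp
  simp only [h1]
  rw [← Fintype.prod_sum fun i j => w i j * (if i = i₀ then h j else 1),
    Finset.prod_eq_single i₀]
  · simp
  · intro i _ hi
    simp [hi, hw]
  · simp

/-! ### Tensor product weights on the cube. -/

section tensor

variable {ι : Type*}

/-- The node of the multi-index `J` in the cube. -/
noncomputable def tensorNode {D : ℕ} (J : ι → Fin (D + 1)) : ι → ℝ := fun i => symmNode D (J i)

lemma tensorNode_mem_Icc {D : ℕ} (J : ι → Fin (D + 1)) :
    tensorNode J ∈ Set.Icc (-1 : ι → ℝ) 1 :=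
  ⟨fun i => (symmNode_mem_Icc (Nat.lt_succ_iff.mp (J i).2)).1,
    fun i => (symmNode_mem_Icc (Nat.lt_succ_iff.mp (J i).2)).2⟩

variable [Fintype ι]

/-- The tensor product Bernstein weight at the multi-index `J`. -/
noncomputable def tensorBernstein {D : ℕ} (J : ι → Fin (D + 1)) (x : ι → ℝ) : ℝ :=
  ∏ i, (symmBernstein D (J i)).eval (x i)

lemma tensorBernstein_mem_coordPoly {D : ℕ} (J : ι → Fin (D + 1)) :
    tensorBernstein J ∈ coordPoly ι D :=
  prod_eval_mem_coordPoly fun i => natDegree_symmBernstein_le (Nat.lt_succ_iff.mp (J i).2)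

lemma tensorBernstein_nonneg {D : ℕ} (J : ι → Fin (D + 1)) {x : ι → ℝ}
    (hx : x ∈ Set.Icc (-1 : ι → ℝ) 1) : 0 ≤ tensorBernstein J x :=
  Finset.prod_nonneg fun i _ => symmBernstein_nonneg D (J i) ⟨hx.1 i, hx.2 i⟩

lemma sum_tensorBernstein [DecidableEq ι] (D : ℕ) (x : ι → ℝ) :
    ∑ J : ι → Fin (D + 1), tensorBernstein J x = 1 := by
  simp only [tensorBernstein]
  rw [← Fintype.prod_sum fun i (j : Fin (D + 1)) => (symmBernstein D j).eval (x i)]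
  simp [sum_symmBernstein]

/-- Union bound: far in the sup distance means far in some coordinate, and the weights of the other
coordinates sum to one. -/
lemma sum_tensorBernstein_far_le [DecidableEq ι] {D : ℕ} (hD : 0 < D) {x : ι → ℝ} {δ : ℝ}
    (hx : x ∈ Set.Icc (-1 : ι → ℝ) 1) (hδ : 0 < δ) (hδ1 : δ ≤ 1) :
    ∑ J : ι → Fin (D + 1), tensorBernstein J x * (if δ ≤ dist x (tensorNode J) then 1 else 0) ≤
      2 * Fintype.card ι * Real.exp (-(δ ^ 2 / 4 * D)) := by
  calc _ ≤ ∑ J : ι → Fin (D + 1), tensorBernstein J x *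
        ∑ i, (if δ ≤ |symmNode D (J i) - x i| then (1 : ℝ) else 0) := by
        refine Finset.sum_le_sum fun J _ => mul_le_mul_of_nonneg_left ?_
          (tensorBernstein_nonneg J hx)
        have h0 : ∀ i, (0 : ℝ) ≤ if δ ≤ |symmNode D (J i) - x i| then (1 : ℝ) else 0 := by
          intro i; split_ifs <;> norm_num
        split_ifs with h
        · obtain ⟨i, hi⟩ : ∃ i, δ ≤ |symmNode D (J i) - x i| := by
            by_contra! hc
            refine absurd h (not_le.mpr ((dist_pi_lt_iff hδ).mpr fun i => ?_))
            rw [dist_comm, Real.dist_eq]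
            exact hc i
          calc (1 : ℝ) = if δ ≤ |symmNode D (J i) - x i| then (1 : ℝ) else 0 := by rw [if_pos hi]
            _ ≤ _ := Finset.single_le_sum
              (f := fun i => if δ ≤ |symmNode D (J i) - x i| then (1 : ℝ) else 0)
              (fun i _ => h0 i) (Finset.mem_univ i)
        · exact Finset.sum_nonneg fun i _ => h0 i
    _ = ∑ i, ∑ J : ι → Fin (D + 1), tensorBernstein J x *
        (if δ ≤ |symmNode D (J i) - x i| then (1 : ℝ) else 0) := by
        rw [Finset.sum_comm]
        simp only [Finset.mul_sum]
    _ ≤ ∑ _i : ι, 2 * Real.exp (-(δ ^ 2 / 4 * D)) := by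
        refine Finset.sum_le_sum fun i _ => ?_
        refine le_of_eq_of_le ?_ (sum_symmBernstein_far_le hD ⟨hx.1 i, hx.2 i⟩ hδ hδ1)
        exact sum_prod_mul_marginal
          (w := fun i (j : Fin (D + 1)) => (symmBernstein D j).eval (x i))
          (fun i => sum_symmBernstein D (x i))
          (fun j => if δ ≤ |symmNode D j - x i| then (1 : ℝ) else 0) i
    _ = _ := by simp; ring

end tensor

/-! ### Geometric approximation of analytic functions. -/

section analytic

variable {ι : Type*} [Fintype ι]

lemma abs_partialSum_le {p : FormalMultilinearSeries ℝ (ι → ℝ) ℝ} {C r R : ℝ} (hC : 0 ≤ C)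
    (hr : 0 ≤ r) (hp : ∀ k, ‖p k‖ ≤ C * r ^ k) {y : ι → ℝ} (hy : ‖y‖ ≤ R) (q : ℕ) :
    |p.partialSum q y| ≤ C * (2 * max 1 (r * R)) ^ q := by
  set A := max 1 (r * R)
  have hA : 1 ≤ A := le_max_left _ _
  calc |p.partialSum q y| ≤ ∑ k ∈ Finset.range q, |p k fun _ => y| :=
        Finset.abs_sum_le_sum_abs _ _
    _ ≤ ∑ _k ∈ Finset.range q, C * A ^ q := by
        refine Finset.sum_le_sum fun k hk => ?_
        calc |p k fun _ => y| ≤ ‖p k‖ * ‖y‖ ^ k := by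
              simpa using (p k).le_opNorm fun _ => y
          _ ≤ (C * r ^ k) * R ^ k := by gcongr; exact hp k
          _ = C * (r * R) ^ k := by rw [mul_pow, mul_assoc]
          _ ≤ C * A ^ k := by
              have : 0 ≤ r * R := mul_nonneg hr ((norm_nonneg y).trans hy)
              gcongr
              exact le_max_right _ _
          _ ≤ C * A ^ q := by
              gcongr
              exact (Finset.mem_range.mp hk).le
    _ = (q : ℝ) * (C * A ^ q) := by simp
    -- The number of terms is absorbed into the geometric rate.
    _ ≤ 2 ^ q * (C * A ^ q) := by
        gcongr
        exact_mod_cast Nat.lt_two_pow_self.le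
    _ = _ := by rw [mul_pow]; ring

/-- Uniform local polynomial approximation of a function analytic near a compact set: geometric
accuracy near the centre, and at most geometric growth on the whole compact set. -/
lemma exists_local_coordPoly_approx {F : (ι → ℝ) → ℝ} {K : Set (ι → ℝ)} (hK : IsCompact K)
    (hF : AnalyticOnNhd ℝ F K) :
    ∃ C a A δ : ℝ, 0 < C ∧ a ∈ Set.Ioo (0 : ℝ) 1 ∧ 1 ≤ A ∧ 0 < δ ∧
      ∀ c ∈ K, ∀ q : ℕ, ∃ T ∈ coordPoly ι q,
        (∀ y, dist y c < δ → |F y - T y| ≤ C * a ^ q) ∧ ∀ y ∈ K, |T y| ≤ C * A ^ q := by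
  refine hK.induction_on (p := fun s => ∃ C a A δ : ℝ, 0 < C ∧ a ∈ Set.Ioo (0 : ℝ) 1 ∧ 1 ≤ A ∧
    0 < δ ∧ ∀ c ∈ s, ∀ q : ℕ, ∃ T ∈ coordPoly ι q,
      (∀ y, dist y c < δ → |F y - T y| ≤ C * a ^ q) ∧ ∀ y ∈ K, |T y| ≤ C * A ^ q) ?_ ?_ ?_ ?_
  · exact ⟨1, 1 / 2, 1, 1, by norm_num, by norm_num, le_rfl, one_pos, by simp⟩
  · rintro s t hst ⟨C, a, A, δ, hC, ha, hA, hδ, h⟩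
    exact ⟨C, a, A, δ, hC, ha, hA, hδ, fun c hc => h c (hst hc)⟩
  · rintro s t ⟨C₁, a₁, A₁, δ₁, hC₁, ha₁, hA₁, hδ₁, h₁⟩ ⟨C₂, a₂, A₂, δ₂, hC₂, ha₂, hA₂, hδ₂, h₂⟩
    have ha₁' := ha₁.1.le
    have ha₂' := ha₂.1.le
    refine ⟨max C₁ C₂, max a₁ a₂, max A₁ A₂, min δ₁ δ₂, lt_max_of_lt_left hC₁,
      ⟨lt_max_of_lt_left ha₁.1, max_lt ha₁.2 ha₂.2⟩, le_max_of_le_left hA₁, lt_min hδ₁ hδ₂, ?_⟩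
    rintro c (hc | hc) q
    · obtain ⟨T, hT, hn, hf⟩ := h₁ c hc q
      refine ⟨T, hT, fun y hy => (hn y (hy.trans_le (min_le_left _ _))).trans ?_,
        fun y hy => (hf y hy).trans ?_⟩
      · gcongr <;> exact le_max_left _ _
      · gcongr <;> exact le_max_left _ _
    · obtain ⟨T, hT, hn, hf⟩ := h₂ c hc q
      refine ⟨T, hT, fun y hy => (hn y (hy.trans_le (min_le_right _ _))).trans ?_,
        fun y hy => (hf y hy).trans ?_⟩
      · gcongr <;> exact le_max_right _ _
      · gcongr <;> exact le_max_right _ _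
  · intro z hz
    obtain ⟨p, R, hp⟩ := hF z hz
    obtain ⟨r, hr0, hrR⟩ := ENNReal.lt_iff_exists_nnreal_btwn.mp hp.r_pos
    have hr : (0 : ℝ) < r := by exact_mod_cast hr0
    obtain ⟨a, ha, C₁, hC₁, h₁⟩ := hp.uniform_geometric_approx hrR
    obtain ⟨C₂, ρ, hC₂, hρ, h₂⟩ := p.le_mul_pow_of_radius_pos hp.radius_pos
    obtain ⟨L, hL⟩ := hK.isBounded.subset_closedBall z
    -- All centres `c` in this ball share the Taylor polynomial at `z`: points within `r / 2` of `c`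
    -- stay within `r` of `z`.
    refine ⟨Metric.ball z (r / 2), mem_nhdsWithin_of_mem_nhds (Metric.ball_mem_nhds z (by positivity)),
      max C₁ C₂, a, 2 * max 1 (ρ * L), r / 2, lt_max_of_lt_left hC₁, ha, ?_, by positivity, ?_⟩
    · linarith [le_max_left 1 (ρ * L)]
    · intro c hc q
      refine ⟨fun x => p.partialSum q (x - z), partialSum_mem_coordPoly p z q, ?_, ?_⟩
      · intro y hy
        have hyz : y - z ∈ Metric.ball (0 : ι → ℝ) r := by
          rw [mem_ball_zero_iff, ← dist_eq_norm]
          linarith [dist_triangle y c z, Metric.mem_ball.mp hc]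
        have h := h₁ (y - z) hyz q
        rw [add_sub_cancel, Real.norm_eq_abs] at h
        refine h.trans ?_
        have := ha.1.le
        gcongr
        exact le_max_left _ _
      · intro y hy
        have hyL : ‖y - z‖ ≤ L := by
          rw [← dist_eq_norm]
          exact hL hy
        refine (abs_partialSum_le hC₂.le hρ.le h₂ hyL q).trans ?_
        gcongr
        exact le_max_right _ _

/-- A function analytic near the cube `[-1, 1]^ι` is approximated geometrically fast by
polynomials. -/
lemma exists_coordPoly_approx {F : (ι → ℝ) → ℝ}
    (hF : AnalyticOnNhd ℝ F (Set.Icc (-1 : ι → ℝ) 1)) :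
    ∃ C a : ℝ, ∃ M : ℕ, 0 < C ∧ a ∈ Set.Ioo (0 : ℝ) 1 ∧ ∀ q : ℕ,
      ∃ P ∈ coordPoly ι (M * (q + 1)), ∀ x ∈ Set.Icc (-1 : ι → ℝ) 1, |F x - P x| ≤ C * a ^ q := by
  classical
  obtain ⟨C, a, A, δ', hC, ha, hA, hδ', h⟩ := exists_local_coordPoly_approx isCompact_Icc hF
  obtain ⟨B, hB⟩ := isCompact_Icc.exists_bound_of_continuousOn hF.continuousOn
  have hB0 : 0 ≤ B := (norm_nonneg _).trans (hB 0 ⟨by intro i; simp, by intro i; simp⟩)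
  set δ := min δ' 1 with hδdef
  have hδ : 0 < δ := lt_min hδ' one_pos
  have hA0 : 0 < A := one_pos.trans_le hA
  -- `M` makes the Bernstein tail, of rate `exp (-δ² / 4) ^ M`, beat the growth `A` and still leave
  -- rate `a`.
  obtain ⟨M, hM⟩ := exists_pow_lt_of_lt_one (div_pos ha.1 hA0)
    (Real.exp_lt_one_iff.mpr (by nlinarith : -(δ ^ 2 / 4) < 0))
  have hM0 : 0 < M := by
    rcases Nat.eq_zero_or_pos M with rfl | h0
    · rw [pow_zero, lt_div_iff₀ hA0] at hM
      linarith [ha.2]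
    · exact h0
  refine ⟨C + (B + C) * (2 * Fintype.card ι), a, M + 1, by positivity, ha, fun q => ?_⟩
  -- The `+ 1` keeps `D` positive at `q = 0`.
  set D := M * (q + 1) with hDdef
  have hD : 0 < D := by positivity
  choose T hT hn hf using fun J : ι → Fin (D + 1) => h (tensorNode J) (tensorNode_mem_Icc J) q
  refine ⟨∑ J, tensorBernstein J * T J, Submodule.sum_mem _ fun J _ => ?_, fun x hx => ?_⟩
  · refine coordPoly_mono ?_ (mul_mem_coordPoly (tensorBernstein_mem_coordPoly J) (hT J))
    rw [hDdef, add_mul]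
    omega
  · have hpos := fun J => tensorBernstein_nonneg (D := D) J hx
    have hone : 1 ≤ A ^ q := one_le_pow₀ hA
    have hdiff : F x - (∑ J, tensorBernstein J * T J) x =
        ∑ J, tensorBernstein (D := D) J x * (F x - T J x) := by
      simp only [mul_sub, Finset.sum_sub_distrib, ← Finset.sum_mul, sum_tensorBernstein]
      simp
    have hexp : A ^ q * Real.exp (-(δ ^ 2 / 4 * D)) ≤ a ^ q := by
      have h1 : Real.exp (-(δ ^ 2 / 4 * D)) ≤ (Real.exp (-(δ ^ 2 / 4)) ^ M) ^ q := by
        rw [← pow_mul, ← Real.exp_nat_mul, Real.exp_le_exp, hDdef]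
        push_cast
        nlinarith [mul_nonneg (sq_nonneg δ) (Nat.cast_nonneg (α := ℝ) M)]
      calc A ^ q * Real.exp (-(δ ^ 2 / 4 * D)) ≤ A ^ q * (a / A) ^ q := by
            gcongr
            refine h1.trans ?_
            gcongr
        _ = a ^ q := by rw [← mul_pow, mul_div_cancel₀ _ hA0.ne']
    rw [hdiff]
    calc |∑ J, tensorBernstein (D := D) J x * (F x - T J x)|
        ≤ ∑ J, tensorBernstein (D := D) J x * (C * a ^ q +
          (B + C) * A ^ q * (if δ ≤ dist x (tensorNode J) then 1 else 0)) := by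
          refine (Finset.abs_sum_le_sum_abs _ _).trans (Finset.sum_le_sum fun J _ => ?_)
          rw [abs_mul, abs_of_nonneg (hpos J)]
          refine mul_le_mul_of_nonneg_left ?_ (hpos J)
          have haq : 0 < a ^ q := pow_pos ha.1 q
          -- Far nodes cost `B + C * A ^ q`, with `B` bounding `F`; near nodes have the Taylor
          -- error.
          split_ifs with hd
          · have h1 := hB x hx
            rw [Real.norm_eq_abs] at h1
            have h2 := hf J x hx
            have h3 : B ≤ B * A ^ q := le_mul_of_one_le_right hB0 hone
            have h4 := abs_sub (F x) (T J x)
            have h5 : 0 < C * a ^ q := by positivity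
            linarith
          · have h1 := hn J x ((not_le.mp hd).trans_le (min_le_left _ _))
            linarith
      _ = C * a ^ q + (B + C) * A ^ q * ∑ J, tensorBernstein (D := D) J x *
          (if δ ≤ dist x (tensorNode J) then 1 else 0) := by
          have hsum : C * a ^ q = ∑ J, tensorBernstein (D := D) J x * (C * a ^ q) := by
            rw [← Finset.sum_mul, sum_tensorBernstein, one_mul]
          conv_rhs => rw [hsum, Finset.mul_sum, ← Finset.sum_add_distrib]
          exact Finset.sum_congr rfl fun J _ => by ring
      _ ≤ C * a ^ q + (B + C) * A ^ q *
          (2 * Fintype.card ι * Real.exp (-(δ ^ 2 / 4 * D))) := by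
          gcongr
          exact sum_tensorBernstein_far_le hD hx hδ (min_le_right _ _)
      _ = C * a ^ q + (B + C) * (2 * Fintype.card ι) *
          (A ^ q * Real.exp (-(δ ^ 2 / 4 * D))) := by ring
      _ ≤ C * a ^ q + (B + C) * (2 * Fintype.card ι) * a ^ q := by gcongr
      _ = _ := by ring

end analytic

/-! ### Separation of the variables and reduction to a single cube. -/

/-- A family of functions on `ℝⁿ × ℝᵐ` given by Chebyshev expansions of order at most `p` in each
variable factors as `Θ * B x * ξ d`. -/
lemma exists_chebyshev_factorization {n m p s₁ s₂ : ℕ} (hs₁ : s₁ = (p + 1) ^ (m + n))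
    (hs₂ : s₂ = (p + 1) ^ m) (a : Fin n → (Fin n ⊕ Fin m → Fin (p + 1)) → ℝ) :
    ∃ (Θ : Matrix (Fin n) (Fin s₁) ℝ) (B : (Fin n → ℝ) → Matrix (Fin s₁) (Fin s₂) ℝ)
      (ξ : (Fin m → ℝ) → Fin s₂ → ℝ), IsChebyshevMatrix p B ∧ IsChebyshevVector p ξ ∧
      ∀ x d i, Matrix.mulVec (Θ * B x) (ξ d) i = ∑ k, a i k *
        ∏ l, (Polynomial.Chebyshev.T ℝ ((k l : ℕ) : ℤ)).eval (Sum.elim x d l) := by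
  have e₁ : Fin s₁ ≃ (Fin n ⊕ Fin m → Fin (p + 1)) :=
    (Fintype.equivFinOfCardEq (by simp [hs₁, add_comm])).symm
  have e₂ : Fin s₂ ≃ (Fin m → Fin (p + 1)) :=
    (Fintype.equivFinOfCardEq (by simp [hs₂])).symm
  -- Rows of `B` are indexed by full multi-indices, columns by their `d`-parts. Each row has an
  -- entry only in its matching column, so `B x` times `ξ d` lists all the products.
  refine ⟨Matrix.of fun i s => a i (e₁ s), fun x => Matrix.of fun s t => if (fun l => e₁ s (Sum.inr l)) = e₂ t then
      ∏ l, (Polynomial.Chebyshev.T ℝ ((e₁ s (Sum.inl l) : ℕ) : ℤ)).eval (x l) else 0,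
    fun d t => ∏ l, (Polynomial.Chebyshev.T ℝ ((e₂ t l : ℕ) : ℤ)).eval (d l), ?_, ?_, ?_⟩
  · intro s t
    by_cases h : (fun l => e₁ s (Sum.inr l)) = e₂ t
    · exact Or.inr ⟨fun l => e₁ s (Sum.inl l), fun l => Nat.lt_succ_iff.mp (e₁ s (Sum.inl l)).2,
        fun x => if_pos h⟩
    · exact Or.inl fun x => if_neg h
  · exact fun t => ⟨fun l => e₂ t l, fun l => Nat.lt_succ_iff.mp (e₂ t l).2, fun d => rfl⟩
  · intro x d i
    rw [← Matrix.mulVec_mulVec, Matrix.mulVec, dotProduct,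
      ← e₁.sum_comp fun k => a i k *
        ∏ l, (Polynomial.Chebyshev.T ℝ ((k l : ℕ) : ℤ)).eval (Sum.elim x d l)]
    refine Finset.sum_congr rfl fun s _ => ?_
    rw [Matrix.of_apply]
    congr 1
    rw [Matrix.mulVec, dotProduct, Finset.sum_eq_single (e₂.symm fun l => e₁ s (Sum.inr l))]
    · simp [Fintype.prod_sum_type]
    · intro t _ ht
      have h : (fun l => e₁ s (Sum.inr l)) ≠ e₂ t := fun h =>
        ht (by rw [h, Equiv.symm_apply_apply])
      simp [h]
    · simp

lemma exists_uniform_chebyshev_approx {n m : ℕ} (hn : 0 < n)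
    (Δ : (Fin n → ℝ) → (Fin m → ℝ) → EuclideanSpace ℝ (Fin n))
    (hΔ : ∀ i : Fin n, AnalyticOnNhd ℝ
      (fun z : (Fin n → ℝ) × (Fin m → ℝ) => Δ z.1 z.2 i)
      (Set.Icc (-1 : Fin n → ℝ) 1 ×ˢ Set.Icc (-1 : Fin m → ℝ) 1)) :
    ∃ C a : ℝ, ∃ M : ℕ, 0 < C ∧ a ∈ Set.Ioo (0 : ℝ) 1 ∧ ∀ q : ℕ,
      ∃ c : Fin n → (Fin n ⊕ Fin m → Fin (M * (q + 1) + 1)) → ℝ,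
        ∀ x ∈ Set.Icc (-1 : Fin n → ℝ) 1, ∀ d ∈ Set.Icc (-1 : Fin m → ℝ) 1, ∀ i,
          |Δ x d i - ∑ k, c i k *
            ∏ l, (Polynomial.Chebyshev.T ℝ ((k l : ℕ) : ℤ)).eval (Sum.elim x d l)| ≤ C * a ^ q := by
  have hF : ∀ i, AnalyticOnNhd ℝ (fun z : Fin n ⊕ Fin m → ℝ =>
      Δ (fun j => z (Sum.inl j)) (fun j => z (Sum.inr j)) i) (Set.Icc (-1) 1) := by
    intro i
    have hlin : AnalyticOnNhd ℝ (fun z : Fin n ⊕ Fin m → ℝ =>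
        ((fun j => z (Sum.inl j) : Fin n → ℝ), (fun j => z (Sum.inr j) : Fin m → ℝ)))
        (Set.Icc (-1) 1) :=
      fun z _ => ContinuousLinearMap.analyticAt
        ((ContinuousLinearMap.pi fun j => ContinuousLinearMap.proj (R := ℝ) (Sum.inl j)).prod
          (ContinuousLinearMap.pi fun j => ContinuousLinearMap.proj (R := ℝ) (Sum.inr j))) z
    exact (hΔ i).comp hlin fun z hz =>
      ⟨⟨fun j => hz.1 _, fun j => hz.2 _⟩, ⟨fun j => hz.1 _, fun j => hz.2 _⟩⟩
  choose C a M hC ha h using fun i => exists_coordPoly_approx (hF i)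
  have : Nonempty (Fin n) := ⟨⟨0, hn⟩⟩
  obtain ⟨i₁, h₁⟩ := Finite.exists_max C
  obtain ⟨i₂, h₂⟩ := Finite.exists_max a
  obtain ⟨i₃, h₃⟩ := Finite.exists_max M
  refine ⟨C i₁, a i₂, M i₃, hC i₁, ha i₂, fun q => ?_⟩
  choose P hP hPF using fun i => h i q
  choose c hc using fun i => exists_chebyshev_coeff_of_mem_coordPoly
    (coordPoly_mono (Nat.mul_le_mul_right (q + 1) (h₃ i)) (hP i))
  refine ⟨c, fun x hx d hd i => ?_⟩
  rw [← hc i]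
  have hmem : Sum.elim x d ∈ Set.Icc (-1 : Fin n ⊕ Fin m → ℝ) 1 := by
    constructor <;> rintro (j | j)
    exacts [hx.1 j, hd.1 j, hx.2 j, hd.2 j]
  refine (hPF i _ hmem).trans ?_
  have := (ha i).1.le
  have := (hC i₁).le
  gcongr
  exacts [h₁ i, h₂ i]

/-! ### From geometric error to logarithmic degree. -/

lemma isBigO_degree_of_geometric_rate {C L b : ℝ} (hC : 0 < C) (hL : 0 < L) (hb : 0 < b) (M : ℕ) :
    (fun ε : ℝ => ((M * (⌈Real.log (C / ε) / L⌉₊ + 1) + 1 : ℕ) : ℝ)) =O[𝓝[>] (0 : ℝ)]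
      fun ε => Real.log (b / ε) := by
  have hlim : Tendsto (fun ε : ℝ => Real.log (b / ε)) (𝓝[>] 0) atTop := by
    refine Real.tendsto_log_atTop.comp ?_
    exact (tendsto_inv_nhdsGT_zero.const_mul_atTop hb).congr fun ε => (div_eq_mul_inv b ε).symm
  -- Replacing `C` by `b` only shifts the logarithm by `log (C / b)`, at most `l` for small `ε`;
  -- constants are absorbed by `1 ≤ l`.
  refine IsBigO.of_bound (M * (2 / L + 2) + 1) ?_
  filter_upwards [hlim.eventually_ge_atTop (max 1 (Real.log (C / b))), self_mem_nhdsWithin]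
    with ε hε hpos
  have hpos : 0 < ε := hpos
  set l := Real.log (b / ε) with hl
  have hl1 : 1 ≤ l := (le_max_left _ _).trans hε
  have hlog : Real.log (C / ε) ≤ 2 * l := by
    have : C / ε = C / b * (b / ε) := by field_simp
    rw [this, Real.log_mul (by positivity) (by positivity), ← hl]
    linarith [(le_max_right 1 (Real.log (C / b))).trans hε]
  have hceil : (⌈Real.log (C / ε) / L⌉₊ : ℝ) ≤ 2 / L * l + 1 := by
    have h0 : 0 ≤ 2 / L * l := by positivity
    calc (⌈Real.log (C / ε) / L⌉₊ : ℝ) ≤ ⌈2 / L * l⌉₊ := by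
          have : Real.log (C / ε) / L ≤ 2 / L * l := by
            rw [div_le_iff₀ hL]
            field_simp
            linarith
          exact_mod_cast Nat.ceil_mono this
      _ ≤ _ := (Nat.ceil_lt_add_one h0).le
  rw [Real.norm_of_nonneg (by positivity), Real.norm_of_nonneg (by linarith)]
  push_cast
  calc (M : ℝ) * (⌈Real.log (C / ε) / L⌉₊ + 1) + 1 ≤ M * (2 / L * l + 1 + 1) + 1 := by gcongr
    _ ≤ M * (2 / L * l + l + l) + l := by gcongr
    _ = _ := by ring

lemma mul_pow_ceil_log_le {C a ε : ℝ} (hC : 0 < C) (ha : a ∈ Set.Ioo (0 : ℝ) 1) (hε : 0 < ε) :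
    C * a ^ ⌈Real.log (C / ε) / -Real.log a⌉₊ ≤ ε := by
  have hL : 0 < -Real.log a := neg_pos.mpr (Real.log_neg ha.1 ha.2)
  have h1 := Nat.le_ceil (Real.log (C / ε) / -Real.log a)
  set q := ⌈Real.log (C / ε) / -Real.log a⌉₊
  rw [div_le_iff₀ hL, Real.log_div hC.ne' hε.ne'] at h1
  rw [← Real.log_le_log_iff (mul_pos hC (pow_pos ha.1 q)) hε,
    Real.log_mul hC.ne' (pow_pos ha.1 q).ne', Real.log_pow]
  linarith

/-- The factor `n` is cruder than `√n`, but it only changes a constant inside the logarithm. -/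
lemma euclidean_norm_le_card_mul {n : ℕ} {v : EuclideanSpace ℝ (Fin n)} {b : ℝ}
    (hv : ∀ i, |v i| ≤ b) : ‖v‖ ≤ n * b := by
  calc ‖v‖ = ‖∑ i, v i • EuclideanSpace.basisFun (Fin n) ℝ i‖ := by
        conv_lhs => rw [← (EuclideanSpace.basisFun (Fin n) ℝ).sum_repr v]
        simp
    _ ≤ ∑ i, |v i| := (norm_sum_le _ _).trans (Finset.sum_le_sum fun i _ => by
        rw [norm_smul, (EuclideanSpace.basisFun (Fin n) ℝ).norm_eq_one, mul_one, Real.norm_eq_abs])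
    _ ≤ ∑ _i : Fin n, b := Finset.sum_le_sum fun i _ => hv i
    _ = n * b := by simp

theorem theorem1 (n m : ℕ) (hn : 0 < n)
    (Δ : (Fin n → ℝ) → (Fin m → ℝ) → EuclideanSpace ℝ (Fin n))
    (hΔ : ∀ i : Fin n, AnalyticOnNhd ℝ
      (fun z : (Fin n → ℝ) × (Fin m → ℝ) => Δ z.1 z.2 i)
      (Set.Icc (-1 : Fin n → ℝ) 1 ×ˢ Set.Icc (-1 : Fin m → ℝ) 1)) :
    ∃ p s₁ s₂ : ℝ → ℕ,
      (∀ ε : ℝ, 0 < ε →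
        s₁ ε = (p ε + 1) ^ (m + n) ∧ s₂ ε = (p ε + 1) ^ m ∧
        ∃ (Θ : Matrix (Fin n) (Fin (s₁ ε)) ℝ)
          (B : (Fin n → ℝ) → Matrix (Fin (s₁ ε)) (Fin (s₂ ε)) ℝ)
          (ξ : (Fin m → ℝ) → Fin (s₂ ε) → ℝ),
          IsChebyshevMatrix (p ε) B ∧ IsChebyshevVector (p ε) ξ ∧
          ∀ x ∈ Set.Icc (-1 : Fin n → ℝ) 1, ∀ d ∈ Set.Icc (-1 : Fin m → ℝ) 1,
            ‖Δ x d - WithLp.toLp 2 (Matrix.mulVec (Θ * B x) (ξ d))‖ ≤ ε) ∧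
      (fun ε : ℝ => (s₁ ε : ℝ)) =O[𝓝[>] (0 : ℝ)]
        (fun ε : ℝ => Real.log (Real.sqrt n / ε) ^ (m + n)) ∧
      (fun ε : ℝ => (s₂ ε : ℝ)) =O[𝓝[>] (0 : ℝ)]
        (fun ε : ℝ => Real.log (Real.sqrt n / ε) ^ m) := by
  obtain ⟨C, a, M, hC, ha, h⟩ := exists_uniform_chebyshev_approx hn Δ hΔ
  have hn' : (0 : ℝ) < n := by exact_mod_cast hn
  have hnC : 0 < n * C := mul_pos hn' hC
  have hO := isBigO_degree_of_geometric_rate hnC (neg_pos.mpr (Real.log_neg ha.1 ha.2))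
    (Real.sqrt_pos.mpr hn') M
  set q : ℝ → ℕ := fun ε => ⌈Real.log (n * C / ε) / -Real.log a⌉₊ with hq
  refine ⟨fun ε => M * (q ε + 1), fun ε => (M * (q ε + 1) + 1) ^ (m + n),
    fun ε => (M * (q ε + 1) + 1) ^ m, fun ε hε => ⟨rfl, rfl, ?_⟩, ?_, ?_⟩
  · obtain ⟨c, hc⟩ := h (q ε)
    obtain ⟨Θ, B, ξ, hB, hξ, hfac⟩ := exists_chebyshev_factorization rfl rfl c
    refine ⟨Θ, B, ξ, hB, hξ, fun x hx d hd => ?_⟩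
    refine (euclidean_norm_le_card_mul (b := C * a ^ q ε) fun i => ?_).trans ?_
    · simpa [hfac] using hc x hx d hd i
    · rw [← mul_assoc]
      exact mul_pow_ceil_log_le hnC ha hε
  · simpa only [Nat.cast_pow] using hO.pow (m + n)
  · simpa only [Nat.cast_pow] using hO.pow m
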